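/- For integers $p,n\ge 2$ let $\mathsf M_p(n)$ be the hypergraph matching complex: the simplicial complex whose vertices are the $p$-element subsets of $[n]=\{1,\dots,n\}$ and whose faces are the collections of pairwise disjoint such subsets. For an integer $r\ge 0$ let $C_{r-1}(\mathsf M_p(n))$ be the space of oriented simplicial $(r-1)$-chains of $\mathsf M_p(n)$ with complex coefficients, that is, the complex vector space spanned by the ordered faces $(A_1,\dots,A_r)$ subject to the relations $(A_{\tau(1)},\dots,A_{\tau(r)})=\operatorname{sgn}(\tau)\,(A_1,\dots,A_r)$ for $\tau\in S_r$ (for $r=0$ this is the one-dimensional space $C_{-1}$ spanned by the empty face). The symmetric group $S_n$ acts on it by $g\,(A_1,\dots,A_r)=(gA_1,\dots,gA_r)$. For a finite-dimensional complex representation $V$ of $S_n$ with character $\chi_V$, let $$\operatorname{ch}V=\frac1{n!}\sum_{w\in S_n}\chi_V(w)\,\mathsf p_{\operatorname{cyc}(w)}$$ be its Frobenius characteristic, where $\mathsf p_{\operatorname{cyc}(w)}$ is the product of the power sum symmetric functions $\mathsf p_{\ell}$ over the lengths $\ell$ of all cycles of $w$ (fixed points included). Let $\mathsf e_m$ and $\mathsf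 h_m$ be the elementary and the complete homogeneous symmetric functions of degree $m$ in countably many variables, and let $\mathsf f[\mathsf g]$ denote the plethysm of symmetric functions. Then for all integers $p,n\ge 2$ and $0\le r\le\lfloor n/p\rfloor$, $$\operatorname{ch} C_{r-1}(\mathsf M_p(n))=\mathsf e_r[\mathsf h_p]\;\mathsf h_{n-rp}.$$ -/

import Mathlib

open scoped Pointwise

noncomputable section

/-! ## Symmetric functions in countably many variables -/

/-- The ring of symmetric functions over `R` in the variables `x₀, x₁, x₂, …`: formal power series
of bounded degree that are invariant under every permutation of the variables. -/
def SymmFun (R : Type*) [CommRing R] : Subalgebra R (MvPowerSeries ℕ R) where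
  carrier := {f | (∀ σ : Equiv.Perm ℕ, MvPowerSeries.rename σ f = f) ∧
    ∃ N : ℕ, ∀ d : ℕ →₀ ℕ, N < d.degree → MvPowerSeries.coeff d f = 0}
  mul_mem' := by
    classical
    rintro f g ⟨hf, M, hM⟩ ⟨hg, N, hN⟩
    refine ⟨fun σ => by rw [map_mul, hf, hg], M + N, fun d hd => ?_⟩
    rw [MvPowerSeries.coeff_mul]
    refine Finset.sum_eq_zero fun x hx => ?_
    have hx' : x.1 + x.2 = d := Finset.HasAntidiagonal.mem_antidiagonal.1 hx
    have hdeg : x.1.degree + x.2.degree = d.degree := by rw [← hx', map_add]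
    rcases lt_or_ge M x.1.degree with h | h
    · rw [hM _ h, zero_mul]
    · rw [hN _ (by omega), mul_zero]
  add_mem' := by
    rintro f g ⟨hf, M, hM⟩ ⟨hg, N, hN⟩
    refine ⟨fun σ => by rw [map_add, hf, hg], max M N, fun d hd => ?_⟩
    rw [map_add, hM d (lt_of_le_of_lt (le_max_left _ _) hd),
      hN d (lt_of_le_of_lt (le_max_right _ _) hd), add_zero]
  algebraMap_mem' r := by
    classical
    refine ⟨fun σ => AlgHom.commutes _ r, 0, fun d hd => ?_⟩
    have hd0 : d ≠ 0 := by rintro rfl; simp at hd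
    rw [MvPowerSeries.algebraMap_apply, MvPowerSeries.coeff_C, if_neg hd0]

namespace SymmFun

variable (R : Type*) [CommRing R]

/-- A power series whose coefficients do not change when the exponents are permuted is invariant
under permutations of the variables. -/
theorem rename_eq_of_coeff {f : MvPowerSeries ℕ R}
    (hf : ∀ (σ : Equiv.Perm ℕ) (d : ℕ →₀ ℕ),
      MvPowerSeries.coeff (d.embDomain σ.toEmbedding) f = MvPowerSeries.coeff d f)
    (σ : Equiv.Perm ℕ) : MvPowerSeries.rename σ f = f := by
  ext d
  obtain ⟨c, rfl⟩ : ∃ c : ℕ →₀ ℕ, c.embDomain σ.toEmbedding = d := by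
    refine ⟨d.embDomain σ.symm.toEmbedding, ?_⟩
    ext i
    obtain ⟨j, rfl⟩ := σ.surjective i
    have h1 := Finsupp.embDomain_apply_self σ.toEmbedding
      (d.embDomain σ.symm.toEmbedding) j
    have h2 := Finsupp.embDomain_apply_self σ.symm.toEmbedding d (σ j)
    simp only [Equiv.coe_toEmbedding, Equiv.symm_apply_apply] at h1 h2
    rw [h1, h2]
  rw [hf]
  exact MvPowerSeries.coeff_embDomain_rename σ.toEmbedding f c

theorem degree_embDomain (e : ℕ ↪ ℕ) (d : ℕ →₀ ℕ) : (d.embDomain e).degree = d.degree := by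
  rw [Finsupp.degree_apply, Finsupp.degree_apply, Finsupp.support_embDomain, Finset.sum_map]
  exact Finset.sum_congr rfl fun i _ => Finsupp.embDomain_apply_self e d i

open Classical in
/-- The complete homogeneous symmetric function `hₙ`: the sum of all monomials of degree `n`. -/
def hsymm (n : ℕ) : SymmFun R :=
  ⟨fun d : ℕ →₀ ℕ => if d.degree = n then 1 else 0, by
    refine ⟨rename_eq_of_coeff R fun σ d => ?_, n, fun d hd => if_neg hd.ne'⟩
    change ite _ _ _ = ite _ _ _
    rw [degree_embDomain]⟩

open Classical in
/-- The elementary symmetric function `eₙ`: the sum of all square-free monomials of degree `n`. -/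
def esymm (n : ℕ) : SymmFun R :=
  ⟨fun d : ℕ →₀ ℕ => if d.degree = n ∧ ∀ i, d i ≤ 1 then 1 else 0, by
    refine ⟨rename_eq_of_coeff R fun σ d => ?_, n, fun d hd => if_neg fun h => hd.ne' h.1⟩
    change ite _ _ _ = ite _ _ _
    have h : (∀ i, d.embDomain σ.toEmbedding i ≤ 1) ↔ ∀ i, d i ≤ 1 := by
      rw [← σ.forall_congr_right (q := fun i => d.embDomain σ.toEmbedding i ≤ 1)]
      exact forall_congr' fun i => by
        rw [← Equiv.coe_toEmbedding, Finsupp.embDomain_apply_self]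
    rw [degree_embDomain, h]⟩

open Classical in
/-- The power sum `pₙ = ∑ᵢ xᵢⁿ` (only used for `n ≥ 1`). -/
def psum (n : ℕ) : SymmFun R :=
  ⟨fun d : ℕ →₀ ℕ => if ∃ i, d = Finsupp.single i n then 1 else 0, by
    refine ⟨rename_eq_of_coeff R fun σ d => ?_, n, fun d hd => if_neg ?_⟩
    · change ite _ _ _ = ite _ _ _
      have h : (∃ i, d.embDomain σ.toEmbedding = Finsupp.single i n) ↔
          ∃ i, d = Finsupp.single i n := by
        rw [← σ.exists_congr_right
          (q := fun i => d.embDomain σ.toEmbedding = Finsupp.single i n)]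
        refine exists_congr fun i => ?_
        rw [← Equiv.coe_toEmbedding, ← Finsupp.embDomain_single,
          Finsupp.embDomain_inj]
      rw [h]
    · rintro ⟨i, rfl⟩
      simp at hd⟩

variable {R}

/-- The substitution `xᵢ ↦ xᵢᵏ`, i.e. the plethysm `g ↦ pₖ[g]`. -/
def powerSubst (k : ℕ+) : SymmFun R →ₐ[R] SymmFun R :=
  ((MvPowerSeries.expand (k : ℕ) k.ne_zero).comp (SymmFun R).val).codRestrict (SymmFun R) <| by
    rintro ⟨f, hf, N, hN⟩
    have key : ∀ d : ℕ →₀ ℕ, (∃ c : ℕ →₀ ℕ, d = (k : ℕ) • c) ∨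
        ∃ i, ¬ (k : ℕ) ∣ d i := by
      intro d
      by_cases h : ∀ i, (k : ℕ) ∣ d i
      · refine Or.inl ⟨d.mapRange (· / (k : ℕ)) (Nat.zero_div _), ?_⟩
        ext i
        simp [Nat.mul_div_cancel' (h i)]
      · exact Or.inr (not_forall.1 h)
    refine ⟨rename_eq_of_coeff R fun σ d => ?_, k * N, fun d hd => ?_⟩
    · change MvPowerSeries.coeff _ (MvPowerSeries.expand (k : ℕ) k.ne_zero f) =
        MvPowerSeries.coeff _ (MvPowerSeries.expand (k : ℕ) k.ne_zero f)
      rcases key d with ⟨c, rfl⟩ | ⟨i, hi⟩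
      · have h : ((k : ℕ) • c).embDomain σ.toEmbedding =
            (k : ℕ) • c.embDomain σ.toEmbedding := by
          simp only [Finsupp.embDomain_eq_mapDomain, Finsupp.mapDomain_smul]
        rw [h, MvPowerSeries.coeff_expand_smul, MvPowerSeries.coeff_expand_smul]
        conv_lhs => rw [← hf σ]
        exact MvPowerSeries.coeff_embDomain_rename σ.toEmbedding f c
      · rw [MvPowerSeries.coeff_expand_of_not_dvd _ _ f hi,
          MvPowerSeries.coeff_expand_of_not_dvd _ _ f (i := σ i)]
        rwa [← Equiv.coe_toEmbedding, Finsupp.embDomain_apply_self]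
    · change MvPowerSeries.coeff _ (MvPowerSeries.expand (k : ℕ) k.ne_zero f) = 0
      rcases key d with ⟨c, rfl⟩ | ⟨i, hi⟩
      · rw [MvPowerSeries.coeff_expand_smul]
        refine hN c ?_
        rw [map_nsmul, smul_eq_mul] at hd
        exact lt_of_mul_lt_mul_left hd (Nat.zero_le _)
      · exact MvPowerSeries.coeff_expand_of_not_dvd _ _ f hi

open Classical in
/-- Plethysm `f[g]`: write `f = P(p₁, p₂, …)` as a polynomial in the power sums and replace each
`pₖ` by `pₖ[g] = g(x₀ᵏ, x₁ᵏ, …)`. Over `ℂ` the power sums generate the ring of symmetric functions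
and are algebraically independent, so `P` exists and is unique (the value `0` is never used). -/
def plethysm (f g : SymmFun ℂ) : SymmFun ℂ :=
  if h : ∃ P : MvPolynomial ℕ+ ℂ, MvPolynomial.aeval (fun k : ℕ+ => psum ℂ k) P = f then
    MvPolynomial.aeval (fun k : ℕ+ => powerSubst k g) h.choose
  else 0

end SymmFun

/-- The Frobenius characteristic `ch V = (1/n!) ∑_{w ∈ Sₙ} χ_V(w) p_{cyc(w)}` of a finite-dimensional
complex representation of `Sₙ`, where `p_μ = ∏ p_{μᵢ}` and `cyc(w)` is the partition of `n` given
by the lengths of all cycles of `w`, fixed points included. -/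
def frobeniusChar {n : ℕ} {V : Type*} [AddCommGroup V] [Module ℂ V] [Module.Finite ℂ V]
    (ρ : Representation ℂ (Equiv.Perm (Fin n)) V) : SymmFun ℂ :=
  (n.factorial : ℂ)⁻¹ • ∑ w : Equiv.Perm (Fin n),
    ρ.character w • (w.partition.parts.map fun k => SymmFun.psum ℂ k).prod

/-! ## Oriented simplicial chains -/

namespace AbstractSimplicialComplex

variable {V : Type*} (K : AbstractSimplicialComplex V)

/-- Ordered `(r-1)`-dimensional faces `(v₁, …, vᵣ)` of `K`. Mathlib's complexes do not list the empty
face, so for `r = 0` it is added here (it is the unique `(-1)`-dimensional face). -/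
def OrderedFace (r : ℕ) : Type _ :=
  {v : Fin r ↪ V // r = 0 ∨ Finset.univ.map v ∈ K.faces}

namespace OrderedFace

variable {K} {r : ℕ}

/-- Reordering of an ordered face: `(v₁, …, vᵣ) ↦ (v_{τ(1)}, …, v_{τ(r)})`. -/
def reorder (v : OrderedFace K r) (τ : Equiv.Perm (Fin r)) : OrderedFace K r :=
  ⟨τ.toEmbedding.trans v.1, v.2.imp id fun h => by
    rwa [← Finset.map_map, Finset.map_univ_equiv]⟩

instance [Finite V] : Finite (OrderedFace K r) :=
  inferInstanceAs (Finite {v : Fin r ↪ V // r = 0 ∨ Finset.univ.map v ∈ K.faces})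

end OrderedFace

/-- The relations `(v_{τ(1)}, …, v_{τ(r)}) = sgn(τ) (v₁, …, vᵣ)` between ordered faces. -/
def orientationRel (r : ℕ) : Submodule ℂ (OrderedFace K r →₀ ℂ) :=
  Submodule.span ℂ (Set.range fun x : OrderedFace K r × Equiv.Perm (Fin r) =>
    Finsupp.single (x.1.reorder x.2) (1 : ℂ) -
      ((Equiv.Perm.sign x.2 : ℤ) : ℂ) • Finsupp.single x.1 1)

/-- The chain space `C_{r-1}(K)` of the augmented (reduced) oriented simplicial chain complex with
complex coefficients; `r` is the number of vertices of the faces involved. -/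
abbrev ChainSpace (r : ℕ) : Type _ := (OrderedFace K r →₀ ℂ) ⧸ K.orientationRel r

/-- A group acting on the vertices acts simplicially on `K` if it maps faces to faces. -/
def IsSimplicialAction [DecidableEq V] (G : Type*) [Group G] [MulAction G V] : Prop :=
  ∀ (g : G) (s : Finset V), s ∈ K.faces → s.image (fun v => g • v) ∈ K.faces

section Action

variable {K} [DecidableEq V] {G : Type*} [Group G] [MulAction G V]

/-- The action of a group on ordered faces, `g (v₁, …, vᵣ) = (g v₁, …, g vᵣ)`. -/
def IsSimplicialAction.smulFace (hG : K.IsSimplicialAction G) {r : ℕ} (g : G)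
    (v : OrderedFace K r) : OrderedFace K r :=
  ⟨v.1.trans (MulAction.toPerm g).toEmbedding, v.2.imp id fun h => by
    have h' := hG g _ h
    rwa [← Finset.map_map, Finset.map_eq_image (MulAction.toPerm g).toEmbedding]⟩

/-- The permutation representation on the space freely spanned by the ordered faces. -/
def IsSimplicialAction.orderedRep (hG : K.IsSimplicialAction G) (r : ℕ) :
    Representation ℂ G (OrderedFace K r →₀ ℂ) where
  toFun g := Finsupp.lmapDomain ℂ ℂ (hG.smulFace g)
  map_one' := by
    have h : hG.smulFace (r := r) 1 = id := by
      funext v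
      refine Subtype.ext (Function.Embedding.ext fun i => ?_)
      exact one_smul G (v.1 i)
    rw [h, Finsupp.lmapDomain_id]
    rfl
  map_mul' g g' := by
    have h : hG.smulFace (r := r) (g * g') = hG.smulFace g ∘ hG.smulFace g' := by
      funext v
      refine Subtype.ext (Function.Embedding.ext fun i => ?_)
      exact mul_smul g g' (v.1 i)
    rw [h, Finsupp.lmapDomain_comp]
    rfl

/-- The representation of `G` on the chain space `C_{r-1}(K)` determined by a simplicial action:
the class of `(v₁, …, vᵣ)` is sent by `g` to the class of `(g v₁, …, g vᵣ)`. -/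
def IsSimplicialAction.chainRep (hG : K.IsSimplicialAction G) (r : ℕ) :
    Representation ℂ G (K.ChainSpace r) :=
  (hG.orderedRep r).quotient (K.orientationRel r) fun g => by
    rw [orientationRel, Submodule.span_le]
    rintro _ ⟨⟨v, τ⟩, rfl⟩
    refine Submodule.subset_span ⟨(hG.smulFace g v, τ), ?_⟩
    change _ = Finsupp.lmapDomain ℂ ℂ (hG.smulFace g) _
    rw [map_sub, map_smul, Finsupp.lmapDomain_apply, Finsupp.lmapDomain_apply,
      Finsupp.mapDomain_single, Finsupp.mapDomain_single]
    rfl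

end Action

end AbstractSimplicialComplex

/-! ## The hypergraph matching complex -/

/-- The hypergraph matching complex `M_p(n)`: its vertices are the `p`-element subsets of an
`n`-element set, and a collection of vertices is a face iff the sets are pairwise disjoint. -/
def hypergraphMatchingComplex (p n : ℕ) :
    AbstractSimplicialComplex (Set.powersetCard (Fin n) p) where
  faces := {s | s.Nonempty ∧ (s : Set (Set.powersetCard (Fin n) p)).Pairwise
    fun A B => Disjoint (A : Finset (Fin n)) (B : Finset (Fin n))}
  isRelLowerSet_faces := fun _ hs =>
    ⟨hs.1, fun _ hts ht => ⟨ht, hs.2.mono (Finset.coe_subset.2 hts)⟩⟩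
  singleton_mem v := ⟨Finset.singleton_nonempty v, by simp⟩

/-- The natural action of `Sₙ` on `{1, …, n}` induces a simplicial action on `M_p(n)`. -/
theorem hypergraphMatchingComplex_isSimplicialAction (p n : ℕ) :
    (hypergraphMatchingComplex p n).IsSimplicialAction (Equiv.Perm (Fin n)) := by
  rintro g s ⟨hs, hd⟩
  refine ⟨hs.image _, ?_⟩
  intro A hA B hB hAB
  obtain ⟨A', hA', rfl⟩ := Finset.mem_image.1 (Finset.mem_coe.1 hA)
  obtain ⟨B', hB', rfl⟩ := Finset.mem_image.1 (Finset.mem_coe.1 hB)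
  have h : Disjoint (A' : Finset (Fin n)) (B' : Finset (Fin n)) :=
    hd (Finset.mem_coe.2 hA') (Finset.mem_coe.2 hB') fun h => hAB (by rw [h])
  simp only [Set.powersetCard.coe_smul]
  rw [Finset.disjoint_left] at h ⊢
  intro x hx hx'
  exact h (Finset.inv_smul_mem_iff.2 hx) (Finset.inv_smul_mem_iff.2 hx')

/-- The representation of `Sₙ` on `C_{r-1}(M_p(n))`. -/
def matchingChainRep (p n r : ℕ) :
    Representation ℂ (Equiv.Perm (Fin n)) ((hypergraphMatchingComplex p n).ChainSpace r) :=
  (hypergraphMatchingComplex_isSimplicialAction p n).chainRep r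

end

/-! Both sides are compared at each monomial x^d, and they agree term by term in a signed sum over τ
in S_r. The bridge is `coeff_prod_partition`: a colouring invariant under w is constant on cycles,
so the product of power sums over the cycles of w counts the w-invariant colourings of content d.
The same holds for the p_k[h_p], with the monomials of degree p as colours.

Left side: antisymmetrization splits the quotient map onto the chain space, so the character at w is
1/r! times the sum over τ of sgn τ times the number of ordered faces v with w(vτ) = v
(`character_chainRep`). For fixed τ, summing over w the product of this number with the number of
w-invariant colourings is a twisted Burnside sum for S_n acting on pairs (ordered matching,
colouring). An orbit is determined by its contents: r monomials of degree p, one per member, and one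
of degree n - rp for the complement, with product x^d. Reordering by τ permutes the r monomials, so
the sum is n! times the number of τ-invariant content families.

Right side: e_r is 1/r! times the signed sum of the power sum products, because signs cancel over
the stabilizer of a non-injective colouring. Plethysm with h_p turns the colours into monomials of
degree p, and h_{n-rp} supplies the complement, so the same families are counted. -/

noncomputable section

/-! ## Colourings invariant under a permutation -/

namespace Equiv.Perm

variable {α : Type*} [Fintype α] [DecidableEq α]

/-- The cycles of a permutation, fixed points included. -/
abbrev CycleIndex (w : Perm α) : Type _ := w.cycleFactorsFinset ⊕ {a // w a = a}

/-- The length of a cycle. -/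
def cycleLength (w : Perm α) : CycleIndex w → ℕ
  | .inl σ => σ.1.support.card
  | .inr _ => 1

/-- The cycle containing a point. -/
def cycleAt (w : Perm α) (a : α) : CycleIndex w :=
  if h : w a = a then .inr ⟨a, h⟩
  else .inl ⟨w.cycleOf a, cycleOf_mem_cycleFactorsFinset_iff.2 (mem_support.2 h)⟩

theorem cycleLength_pos (w : Perm α) (i : CycleIndex w) : 0 < w.cycleLength i := by
  rcases i with ⟨σ, hσ⟩ | a
  · have h := (mem_cycleFactorsFinset_iff.1 hσ).1
    exact lt_of_lt_of_le zero_lt_two h.two_le_card_support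
  · exact one_pos

theorem cycleAt_eq_iff_sameCycle (w : Perm α) (a b : α) :
    w.cycleAt a = w.cycleAt b ↔ w.SameCycle a b := by
  unfold cycleAt
  by_cases ha : w a = a
  · by_cases hb : w b = b
    · simp only [ha, hb, dite_true, Sum.inr.injEq, Subtype.mk.injEq]
      refine ⟨fun h => h ▸ SameCycle.refl _ _, fun h => ?_⟩
      exact h.eq_of_left ha
    · simp only [ha, hb, dite_true, dite_false, reduceCtorEq, false_iff]
      exact fun h => hb (h.apply_eq_self_iff.1 ha)
  · by_cases hb : w b = b
    · simp only [ha, hb, dite_true, dite_false, reduceCtorEq, false_iff]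
      exact fun h => ha (h.apply_eq_self_iff.2 hb)
    · simp only [ha, hb, dite_false, Sum.inl.injEq, Subtype.mk.injEq]
      refine ⟨fun h => ?_, fun h => h.cycleOf_eq⟩
      have hmem : b ∈ (w.cycleOf a).support := by
        rw [h, mem_support, cycleOf_apply_self]; exact hb
      exact (mem_support_cycleOf_iff.1 hmem).1

theorem card_cycleAt_fiber (w : Perm α) (i : CycleIndex w) :
    (Finset.univ.filter fun a => w.cycleAt a = i).card = w.cycleLength i := by
  rcases i with ⟨σ, hσ⟩ | ⟨a, ha⟩
  · unfold cycleLength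
    congr 1
    ext a
    rw [Finset.mem_filter]
    simp only [Finset.mem_univ, true_and, cycleAt]
    by_cases ha : w a = a
    · simp only [ha, dite_true, reduceCtorEq, false_iff]
      exact fun h => mem_support.1 (mem_cycleFactorsFinset_support_le hσ h) ha
    · simp only [ha, dite_false, Sum.inl.injEq, Subtype.mk.injEq]
      constructor
      · rintro rfl
        rw [mem_support, cycleOf_apply_self]; exact ha
      · exact fun h => (cycle_is_cycleOf h hσ).symm
  · unfold cycleLength
    rw [Finset.card_eq_one]
    refine ⟨a, ?_⟩
    ext b
    rw [Finset.mem_filter, Finset.mem_singleton]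
    simp only [Finset.mem_univ, true_and, cycleAt]
    by_cases hb : w b = b
    · simp [hb]
    · simp only [hb, dite_false, reduceCtorEq, false_iff]
      rintro rfl
      exact hb ha

theorem cycleAt_surjective (w : Perm α) : Function.Surjective w.cycleAt := by
  intro i
  have h : (Finset.univ.filter fun a => w.cycleAt a = i).Nonempty := by
    rw [← Finset.card_pos, card_cycleAt_fiber]; exact w.cycleLength_pos i
  obtain ⟨a, ha⟩ := h
  exact ⟨a, (Finset.mem_filter.1 ha).2⟩

theorem prod_partition_parts {M : Type*} [CommMonoid M] (w : Perm α) (P : ℕ → M) :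
    (w.partition.parts.map P).prod = ∏ i, P (w.cycleLength i) := by
  rw [parts_partition, Fintype.prod_sum_type, Multiset.map_add, Multiset.prod_add]
  congr 1
  · rw [cycleType_def, Multiset.map_map]
    exact (Finset.prod_coe_sort w.cycleFactorsFinset fun σ => P σ.support.card).symm
  · have h : Fintype.card {a // w a = a} = Fintype.card α - w.support.card := by
      rw [Fintype.card_subtype, ← Finset.card_compl]
      congr 1
      ext a
      simp
    simp [cycleLength, h]

theorem apply_eq_of_sameCycle {β ι : Type*} [Finite β] {w : Perm β} {c : β → ι} (hc : c ∘ w = c)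
    {a b : β}
    (h : w.SameCycle a b) : c a = c b := by
  obtain ⟨k, hk⟩ := h.exists_pow_eq'
  have : ∀ m : ℕ, c ((w ^ m) a) = c a := by
    intro m
    induction m with
    | zero => rfl
    | succ m ih => rw [pow_succ', mul_apply, ← ih]; exact congrFun hc _
  rw [← hk.2, this]

/-- Invariant colourings factor uniquely through `cycleAt`, and a cycle contributes its colour's
weight once per point. -/
theorem card_invariant_colourings {ι M : Type*} [AddCommMonoid M] (w : Perm α) (f : ι → M)
    (d : M) :
    Nat.card {c : α → ι // c ∘ w = c ∧ ∑ a, f (c a) = d} =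
      Nat.card {c : CycleIndex w → ι // ∑ i, w.cycleLength i • f (c i) = d} := by
  have hsum : ∀ c : CycleIndex w → ι,
      ∑ a, f (c (w.cycleAt a)) = ∑ i, w.cycleLength i • f (c i) := by
    intro c
    rw [← Finset.sum_fiberwise Finset.univ w.cycleAt]
    refine Finset.sum_congr rfl fun i _ => ?_
    rw [← card_cycleAt_fiber, ← Finset.sum_const]
    exact Finset.sum_congr rfl fun a ha => by rw [(Finset.mem_filter.1 ha).2]
  symm
  refine Nat.card_congr (Equiv.ofBijective (fun c => ⟨c.1 ∘ w.cycleAt, ?_, ?_⟩) ⟨?_, ?_⟩)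
  · funext a
    exact congrArg c.1 ((cycleAt_eq_iff_sameCycle w _ _).2 (sameCycle_apply_left.2 (.refl _ _)))
  · exact (hsum c.1).trans c.2
  · intro c c' h
    exact Subtype.ext (w.cycleAt_surjective.injective_comp_right (Subtype.ext_iff.1 h))
  · rintro ⟨c, hc, hd⟩
    have hs := Function.surjInv_eq w.cycleAt_surjective
    have hcomp : (c ∘ Function.surjInv w.cycleAt_surjective) ∘ w.cycleAt = c := by
      funext a
      exact apply_eq_of_sameCycle hc ((cycleAt_eq_iff_sameCycle w _ _).1 (hs _))
    refine ⟨⟨c ∘ Function.surjInv w.cycleAt_surjective, ?_⟩, Subtype.ext hcomp⟩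
    rw [← hsum, ← hd]
    exact Finset.sum_congr rfl fun a _ => congrArg f (congrFun hcomp a)

end Equiv.Perm

/-! ## Products of power sums -/

section PowerSums

variable {ι R : Type*} [CommRing R] {f : ι → ℕ →₀ ℕ} {P : ℕ → MvPowerSeries ℕ R}

open Classical in
/-- `P k` is the sum of the `k`-th powers of the monomials `x ^ f j`. -/
def IsPowerSumFamily (f : ι → ℕ →₀ ℕ) (P : ℕ → MvPowerSeries ℕ R) : Prop :=
  ∀ k : ℕ, 0 < k → ∀ d : ℕ →₀ ℕ, MvPowerSeries.coeff d (P k) = if ∃ j, d = k • f j then 1 else 0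

/-- Expanding the product chooses one monomial from each factor; injectivity of `f` and positivity
of the exponents recover the colour from the chosen monomial. -/
theorem IsPowerSumFamily.coeff_prod (hP : IsPowerSumFamily f P) (hf : Function.Injective f)
    {I : Type*} [Fintype I] (k : I → ℕ) (hk : ∀ i, 0 < k i) (d : ℕ →₀ ℕ) :
    MvPowerSeries.coeff d (∏ i, P (k i)) =
      (Nat.card {c : I → ι // ∑ i, k i • f (c i) = d} : R) := by
  classical
  have hterm : ∀ l : I →₀ ℕ →₀ ℕ, ∏ i, MvPowerSeries.coeff (l i) (P (k i)) =
      if ∀ i, ∃ j, l i = k i • f j then 1 else 0 := by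
    intro l
    by_cases h : ∀ i, ∃ j, l i = k i • f j
    · rw [if_pos h]
      exact Finset.prod_eq_one fun i _ => by rw [hP _ (hk i), if_pos (h i)]
    · rw [if_neg h]
      obtain ⟨i, hi⟩ := not_forall.1 h
      exact Finset.prod_eq_zero (Finset.mem_univ i) (by rw [hP _ (hk i), if_neg hi])
  rw [MvPowerSeries.coeff_prod, Finset.sum_congr rfl fun l _ => hterm l, Finset.sum_boole]
  congr 1
  rw [← Fintype.card_coe, ← Nat.card_eq_fintype_card]
  symm
  refine Nat.card_congr (Equiv.ofBijective
    (fun c => ⟨Finsupp.equivFunOnFinite.symm fun i => k i • f (c.1 i), ?_⟩) ⟨?_, ?_⟩)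
  · rw [Finset.mem_filter, Finset.mem_finsuppAntidiag]
    exact ⟨⟨c.2, Finset.subset_univ _⟩, fun i => ⟨c.1 i, rfl⟩⟩
  · intro c c' h
    refine Subtype.ext (funext fun i => hf ?_)
    exact nsmul_right_injective (hk i).ne'
      (DFunLike.congr_fun (Subtype.ext_iff.1 h) i)
  · rintro ⟨l, hl⟩
    rw [Finset.mem_filter, Finset.mem_finsuppAntidiag] at hl
    choose c hc using hl.2
    refine ⟨⟨c, ?_⟩, Subtype.ext (Finsupp.ext fun i => (hc i).symm)⟩
    rw [← hl.1.1]
    exact Finset.sum_congr rfl fun i _ => (hc i).symm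

theorem IsPowerSumFamily.coeff_prod_partition (hP : IsPowerSumFamily f P)
    (hf : Function.Injective f) {α : Type*} [Fintype α] [DecidableEq α] (w : Equiv.Perm α)
    (d : ℕ →₀ ℕ) :
    MvPowerSeries.coeff d (w.partition.parts.map P).prod =
      (Nat.card {c : α → ι // c ∘ w = c ∧ ∑ a, f (c a) = d} : R) := by
  rw [w.prod_partition_parts, hP.coeff_prod hf _ w.cycleLength_pos,
    w.card_invariant_colourings]

end PowerSums

/-! ## Generic counting lemmas -/

/-- A twisted form of Burnside's lemma. -/
theorem sum_card_twisted_fixed {G X Y : Type*} [Group G] [Fintype G] [MulAction G X] [Finite X]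
    (t : X → X) (T : Y → Y) (Φ : X → Y) (hΦ : Function.Surjective Φ)
    (horb : ∀ x x', Φ x = Φ x' ↔ ∃ g : G, g • x = x') (ht : ∀ x, Φ (t x) = T (Φ x)) :
    ∑ g : G, Nat.card {x // g • t x = x} = Fintype.card G * Nat.card {y // T y = y} := by
  classical
  have hY : Finite Y := Finite.of_surjective Φ hΦ
  let s := Function.surjInv hΦ
  have hs : ∀ y, Φ (s y) = y := Function.surjInv_eq hΦ
  rw [← Nat.card_eq_fintype_card, ← Nat.card_prod, ← Nat.card_sigma]
  -- The orbit of a fixed point `y` of `T` consists of the translates of `s y`.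
  have hk : ∀ x : X, ∃ k : G, T (Φ x) = Φ x → k • s (Φ x) = t x := by
    intro x
    by_cases hx : T (Φ x) = Φ x
    · obtain ⟨k, hk⟩ := (horb (s (Φ x)) (t x)).1 (by rw [hs, ht, hx])
      exact ⟨k, fun _ => hk⟩
    -- Junk value: `k` matters only over fixed points of `T`.
    · exact ⟨1, fun h => absurd h hx⟩
  choose k hk using hk
  have hinv : ∀ (g : G) (x : X), Φ (g • x) = Φ x := fun g x => ((horb _ _).2 ⟨g, rfl⟩).symm
  have hfix : ∀ (g : G) (x : X), g • t x = x → T (Φ x) = Φ x := fun g x h => by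
    rw [← ht, ← hinv g, h]
  -- For a pair with g • t x = x, the element g * k x carries the representative s (Φ x) to x; it
  -- therefore recovers x, and then g.
  refine Nat.card_congr
    { toFun := fun z => (z.1 * k z.2.1, ⟨Φ z.2.1, hfix _ _ z.2.2⟩)
      invFun := fun z => ⟨z.1 * (k (z.1 • s z.2.1))⁻¹, z.1 • s z.2.1, ?_⟩
      left_inv := ?_
      right_inv := ?_ }
  · rw [← hk (z.1 • s z.2.1) (by rw [hinv, hs, z.2.2]), mul_smul, inv_smul_smul, hinv, hs]
  · rintro ⟨g, x, hx⟩
    have h : (g * k x) • s (Φ x) = x := by rw [mul_smul, hk _ (hfix _ _ hx), hx]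
    exact Sigma.subtype_ext (by simp only [h, mul_inv_cancel_right]) h
  · rintro ⟨g, y, hy⟩
    exact Prod.ext (inv_mul_cancel_right _ _) (Subtype.ext ((hinv _ _).trans (hs _)))

/-- Summing the signs of the stabilizers counts the injective functions. -/
theorem sum_sign_mul_card {α ι : Type*} [Fintype α] [DecidableEq α] (p : (α → ι) → Prop)
    [Finite {c // p c}] :
    ∑ τ : Equiv.Perm α, ((Equiv.Perm.sign τ : ℤ) : ℂ) * Nat.card {c : α → ι // c ∘ τ = c ∧ p c} =
      Nat.card {c : α → ι // Function.Injective c ∧ p c} := by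
  classical
  have hfin := Fintype.ofFinite {c // p c}
  have h1 : ∀ τ : Equiv.Perm α, (Nat.card {c : α → ι // c ∘ τ = c ∧ p c} : ℂ) =
      ∑ c : {c // p c}, if c.1 ∘ τ = c.1 then 1 else 0 := by
    intro τ
    rw [Finset.sum_boole, ← Fintype.card_subtype, ← Nat.card_eq_fintype_card]
    exact congrArg _ (Nat.card_congr ((Equiv.subtypeEquivRight fun c => and_comm).trans
      (Equiv.subtypeSubtypeEquivSubtypeInter p fun c => c ∘ τ = c).symm))
  have h2 : (Nat.card {c : α → ι // Function.Injective c ∧ p c} : ℂ) =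
      ∑ c : {c // p c}, if Function.Injective c.1 then 1 else 0 := by
    rw [Finset.sum_boole, ← Fintype.card_subtype, ← Nat.card_eq_fintype_card]
    exact congrArg _ (Nat.card_congr ((Equiv.subtypeEquivRight fun c => and_comm).trans
      (Equiv.subtypeSubtypeEquivSubtypeInter p Function.Injective).symm))
  simp_rw [h1, h2, Finset.mul_sum]
  rw [Finset.sum_comm]
  refine Finset.sum_congr rfl fun c _ => ?_
  by_cases hc : Function.Injective c.1
  · rw [if_pos hc, Finset.sum_eq_single 1]
    · simp
    · intro τ _ hτ
      rw [if_neg, mul_zero]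
      exact fun h => hτ (Equiv.ext fun a => hc (congrFun h a))
    · simp
  · rw [if_neg hc]
    simp only [Function.Injective, not_forall] at hc
    obtain ⟨a, b, hab, hne⟩ := hc
    -- A transposition of two points of equal colour stabilizes `c`; left multiplication by it
    -- reverses the sign of every term, so the sum equals its own negative.
    have hswap : c.1 ∘ Equiv.swap a b = c.1 := by
      funext x
      simp only [Function.comp_apply, Equiv.swap_apply_def]
      split_ifs with h h' <;> simp [*]
    have key := Equiv.sum_comp (Equiv.mulLeft (Equiv.swap a b)) fun τ : Equiv.Perm α =>
      ((Equiv.Perm.sign τ : ℤ) : ℂ) * if c.1 ∘ τ = c.1 then 1 else 0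
    have hneg : ∀ τ : Equiv.Perm α, ((Equiv.Perm.sign (Equiv.swap a b * τ) : ℤ) : ℂ) *
        (if c.1 ∘ ⇑(Equiv.swap a b * τ) = c.1 then 1 else 0) =
        -(((Equiv.Perm.sign τ : ℤ) : ℂ) * if c.1 ∘ τ = c.1 then 1 else 0) := by
      intro τ
      rw [Equiv.Perm.coe_mul, ← Function.comp_assoc, hswap, map_mul, Equiv.Perm.sign_swap hne]
      split_ifs <;> simp
    refine self_eq_neg.1 (key.symm.trans ?_)
    rw [← Finset.sum_neg_distrib]
    exact Finset.sum_congr rfl fun τ _ => hneg τ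

/-- Functions with the same fibre cardinalities differ by a permutation of the domain. -/
theorem exists_perm_comp_eq {α Z : Type*} [Fintype α] [DecidableEq Z] {F F' : α → Z}
    (h : ∀ z, (Finset.univ.filter fun a => F a = z).card =
      (Finset.univ.filter fun a => F' a = z).card) : ∃ σ : Equiv.Perm α, F' ∘ σ = F := by
  classical
  have e : ∀ z, Nonempty ({a // F a = z} ≃ {a // F' a = z}) := fun z =>
    Fintype.card_eq.1 (by rw [Fintype.card_subtype, Fintype.card_subtype, h])
  exact ⟨Equiv.ofFiberEquiv fun z => (e z).some, funext fun a => Equiv.ofFiberEquiv_map _ a⟩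

/-- Any fibre cardinalities with the right total are attained. -/
theorem exists_card_fiber_eq {α Z : Type*} [Fintype α] [DecidableEq Z] (N : Z →₀ ℕ)
    (h : N.degree = Fintype.card α) :
    ∃ F : α → Z, ∀ z, (Finset.univ.filter fun a => F a = z).card = N z := by
  classical
  have hc : Fintype.card (Σ z : N.support, Fin (N z)) = Fintype.card α := by
    rw [Fintype.card_sigma, ← h, Finsupp.degree_apply, ← Finset.sum_coe_sort N.support]
    exact Finset.sum_congr rfl fun z _ => Fintype.card_fin _
  obtain ⟨e⟩ := Fintype.card_eq.1 hc.symm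
  refine ⟨fun a => (e a).1, fun z => ?_⟩
  rw [Finset.card_filter, Equiv.sum_comp e fun x => if (x.1 : Z) = z then 1 else 0,
    Fintype.sum_sigma]
  have h' : ∀ y : N.support, (∑ _i : Fin (N y), if (y : Z) = z then 1 else 0) =
      N y * if (y : Z) = z then 1 else 0 := fun y => by simp
  refine (Finset.sum_congr rfl fun y _ => h' y).trans ?_
  rw [Finset.sum_coe_sort N.support fun y => N y * if y = z then 1 else 0]
  simp only [mul_ite, mul_one, mul_zero, Finset.sum_ite_eq', Finsupp.mem_support_iff, ne_eq,
    ite_not, ite_eq_right_iff]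
  exact Eq.symm

/-! ## Elementary symmetric functions and plethysm -/

namespace SymmFun

theorem coe_hsymm_coeff (R : Type*) [CommRing R] (n : ℕ) (d : ℕ →₀ ℕ) :
    MvPowerSeries.coeff d (hsymm R n : MvPowerSeries ℕ R) = if d.degree = n then 1 else 0 := by
  classical
  exact if_congr Iff.rfl rfl rfl

theorem isPowerSumFamily_psum (R : Type*) [CommRing R] :
    IsPowerSumFamily (fun j : ℕ => Finsupp.single j 1) fun k => (psum R k : MvPowerSeries ℕ R) := by
  classical
  intro k _ d
  have h : ∀ j : ℕ, k • Finsupp.single j 1 = Finsupp.single j k := fun j => by simp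
  exact if_congr (exists_congr fun j => by rw [h]) rfl rfl

theorem single_one_injective : Function.Injective fun j : ℕ => Finsupp.single j (1 : ℕ) :=
  Finsupp.single_left_injective one_ne_zero

theorem sum_single_one_apply {α : Type*} [Fintype α] (c : α → ℕ) (i : ℕ) :
    (∑ a, Finsupp.single (c a) 1 : ℕ →₀ ℕ) i = (Finset.univ.filter fun a => c a = i).card := by
  rw [Finsupp.finsetSum_apply, Finset.card_filter]
  exact Finset.sum_congr rfl fun a _ => Finsupp.single_apply

theorem degree_sum_single_one {α : Type*} (s : Finset α) (c : α → ℕ) :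
    (∑ a ∈ s, Finsupp.single (c a) 1 : ℕ →₀ ℕ).degree = s.card := by
  rw [map_sum]
  simp

theorem finite_colourings {α : Type*} [Fintype α] (d : ℕ →₀ ℕ) :
    Finite {c : α → ℕ // ∑ a, Finsupp.single (c a) 1 = d} := by
  have h : ∀ c : {c : α → ℕ // ∑ a, Finsupp.single (c a) 1 = d}, ∀ a, c.1 a ∈ d.support := by
    rintro ⟨c, rfl⟩ a
    rw [Finsupp.mem_support_iff, sum_single_one_apply, Finset.card_ne_zero]
    exact ⟨a, by simp⟩
  refine Finite.of_injective (β := α → d.support) (fun c a => ⟨c.1 a, h c a⟩) fun c c' hcc => ?_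
  exact Subtype.ext (funext fun a => congrArg Subtype.val (congrFun hcc a))

open Classical in
-- An injective colouring uses each colour at most once, so it is a bijection from `Fin r` onto the
-- support of its content.
theorem card_injective_colourings (r : ℕ) (d : ℕ →₀ ℕ) :
    Nat.card {c : Fin r → ℕ // Function.Injective c ∧ ∑ a, Finsupp.single (c a) 1 = d} =
      if d.degree = r ∧ ∀ i, d i ≤ 1 then r.factorial else 0 := by
  split_ifs with h
  · obtain ⟨hr, h1⟩ := h
    have hsupp : ∀ i, d i = if i ∈ d.support then 1 else 0 := by
      intro i
      have := h1 i
      split_ifs with hi <;> rw [Finsupp.mem_support_iff] at hi <;> omega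
    have hcard : Fintype.card (Fin r) = Fintype.card d.support := by
      rw [Fintype.card_fin, Fintype.card_coe, ← hr, Finsupp.degree_apply, Finset.card_eq_sum_ones]
      exact Finset.sum_congr rfl fun i hi => by rw [hsupp, if_pos hi]
    obtain ⟨e⟩ := Fintype.card_eq.1 hcard
    have : r.factorial = Nat.card (Fin r ≃ d.support) := by
      rw [Nat.card_eq_fintype_card, Fintype.card_equiv e, Fintype.card_fin]
    rw [this]
    symm
    refine Nat.card_congr (Equiv.ofBijective (fun g => ⟨fun a => g a, ?_, ?_⟩) ⟨?_, ?_⟩)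
    · exact Subtype.val_injective.comp g.injective
    · ext i
      rw [sum_single_one_apply, hsupp]
      split_ifs with hi
      · rw [Finset.card_eq_one]
        refine ⟨g.symm ⟨i, hi⟩, ?_⟩
        ext a
        simp only [Finset.mem_filter, Finset.mem_univ, true_and, Finset.mem_singleton]
        rw [Equiv.eq_symm_apply, Subtype.ext_iff]
      · rw [Finset.card_eq_zero, Finset.filter_eq_empty_iff]
        rintro a - rfl
        exact hi (g a).2
    · intro g g' hg
      exact Equiv.ext fun a => Subtype.ext (congrFun (Subtype.ext_iff.1 hg) a)
    · rintro ⟨c, hc, hd⟩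
      have hmem : ∀ a, c a ∈ d.support := by
        intro a
        rw [Finsupp.mem_support_iff, ← hd, sum_single_one_apply, Finset.card_ne_zero]
        exact ⟨a, by simp⟩
      have hinj : Function.Injective fun a => (⟨c a, hmem a⟩ : d.support) := fun a b hab =>
        hc (Subtype.ext_iff.1 hab)
      exact ⟨Equiv.ofBijective _ ((Fintype.bijective_iff_injective_and_card _).2 ⟨hinj, hcard⟩),
        rfl⟩
  · rw [Nat.card_eq_zero]
    left
    refine ⟨?_⟩
    rintro ⟨c, hc, rfl⟩
    refine h ⟨by rw [degree_sum_single_one]; simp, fun i => ?_⟩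
    rw [sum_single_one_apply, Finset.card_le_one]
    intro a ha b hb
    exact hc ((Finset.mem_filter.1 ha).2.trans (Finset.mem_filter.1 hb).2.symm)

theorem coe_multiset_prod {R : Type*} [CommRing R] (s : Multiset ℕ) (P : ℕ → SymmFun R) :
    ((s.map P).prod : SymmFun R).1 = (s.map fun k => (P k : MvPowerSeries ℕ R)).prod := by
  have h := map_multiset_prod (SymmFun R).val (s.map P)
  rw [Multiset.map_map] at h
  exact h

open Classical in
-- The coefficient of x^d on the right is a signed count of τ-invariant colourings, in which only
-- the injective colourings survive.
theorem factorial_smul_esymm (r : ℕ) :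
    (r.factorial : ℂ) • esymm ℂ r = ∑ τ : Equiv.Perm (Fin r),
      ((Equiv.Perm.sign τ : ℤ) : ℂ) • (τ.partition.parts.map fun k => psum ℂ k).prod := by
  refine Subtype.ext (MvPowerSeries.ext fun d => ?_)
  have := finite_colourings (α := Fin r) d
  have hsum : (∑ τ : Equiv.Perm (Fin r), ((Equiv.Perm.sign τ : ℤ) : ℂ) •
      (τ.partition.parts.map fun k => psum ℂ k).prod : SymmFun ℂ).1 =
      ∑ τ : Equiv.Perm (Fin r), ((Equiv.Perm.sign τ : ℤ) : ℂ) •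
        (τ.partition.parts.map fun k => (psum ℂ k : MvPowerSeries ℕ ℂ)).prod := by
    rw [← Subalgebra.val_apply, map_sum]
    refine Finset.sum_congr rfl fun τ _ => ?_
    rw [map_smul, Subalgebra.val_apply, coe_multiset_prod]
  rw [hsum, map_sum]
  simp only [map_smul, smul_eq_mul,
    (isPowerSumFamily_psum ℂ).coeff_prod_partition single_one_injective]
  rw [sum_sign_mul_card fun c : Fin r → ℕ => ∑ a, Finsupp.single (c a) 1 = d,
    card_injective_colourings]
  change MvPowerSeries.coeff d ((r.factorial : ℂ) • (esymm ℂ r : MvPowerSeries ℕ ℂ)) = _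
  rw [map_smul]
  change (r.factorial : ℂ) * (if d.degree = r ∧ ∀ i, d i ≤ 1 then 1 else 0) = _
  split_ifs <;> simp

/-- h_p contains each monomial of degree p exactly once, so p_k[h_p] is the sum of their k-th
powers. `toPNat'` alters only k = 0, which is excluded in `IsPowerSumFamily`. -/
theorem isPowerSumFamily_powerSubst (R : Type*) [CommRing R] (p : ℕ) :
    IsPowerSumFamily (Subtype.val : {m : ℕ →₀ ℕ // m.degree = p} → ℕ →₀ ℕ)
      fun k => (powerSubst k.toPNat' (hsymm R p) : MvPowerSeries ℕ R) := by
  classical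
  intro k hk d
  have hk' : (k.toPNat' : ℕ) = k := by simp [hk]
  change MvPowerSeries.coeff d
    (MvPowerSeries.expand (k.toPNat' : ℕ) (k.toPNat').ne_zero (hsymm R p : MvPowerSeries ℕ R)) = _
  by_cases h : ∀ i, k ∣ d i
  · obtain ⟨c, rfl⟩ : ∃ c : ℕ →₀ ℕ, d = k • c := by
      refine ⟨d.mapRange (· / k) (Nat.zero_div _), ?_⟩
      ext i
      simp [Nat.mul_div_cancel' (h i)]
    have hc := MvPowerSeries.coeff_expand_smul (k.toPNat' : ℕ) (k.toPNat').ne_zero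
      (hsymm R p : MvPowerSeries ℕ R) c
    have hkc : k • c = (k.toPNat' : ℕ) • c := by rw [hk']
    have hc' := (congrArg (fun x => MvPowerSeries.coeff x (MvPowerSeries.expand (k.toPNat' : ℕ)
      (k.toPNat').ne_zero (hsymm R p : MvPowerSeries ℕ R))) hkc).trans hc
    rw [hc', coe_hsymm_coeff]
    refine if_congr ⟨fun h => ⟨⟨c, h⟩, rfl⟩, ?_⟩ rfl rfl
    rintro ⟨⟨m, hm⟩, hcm⟩
    rwa [nsmul_right_injective hk.ne' hcm]
  · obtain ⟨i, hi⟩ := not_forall.1 h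
    rw [MvPowerSeries.coeff_expand_of_not_dvd (i := i), if_neg]
    · rintro ⟨m, rfl⟩
      exact hi ⟨m.1 i, rfl⟩
    · rwa [hk']

/-! ### Substituting monomials for the variables -/

section Substitution

variable {e : ℕ → ℕ →₀ ℕ}

theorem hasSubst_monomial (he : Function.Injective e) (he0 : ∀ j, e j ≠ 0) :
    MvPowerSeries.HasSubst fun j => (MvPowerSeries.monomial (e j) 1 : MvPowerSeries ℕ ℂ) where
  const_coeff j := by
    classical
    rw [← MvPowerSeries.coeff_zero_eq_constantCoeff_apply, MvPowerSeries.coeff_monomial,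
      if_neg (he0 j).symm]
    exact IsNilpotent.zero
  coeff_zero d := by
    classical
    refine Set.Subsingleton.finite fun i hi j hj => he ?_
    simp only [MvPowerSeries.coeff_monomial, ne_eq, ite_eq_right_iff, one_ne_zero, imp_false,
      not_not, Set.mem_ofPred_eq] at hi hj
    rw [← hi, ← hj]

theorem isPowerSumFamily_subst_psum (he : Function.Injective e) (he0 : ∀ j, e j ≠ 0) :
    IsPowerSumFamily e fun k => MvPowerSeries.substAlgHom (R := ℂ) (hasSubst_monomial he he0)
      (psum ℂ k : MvPowerSeries ℕ ℂ) := by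
  classical
  intro k hk d
  have hprod : ∀ j, MvPowerSeries.coeff d ((Finsupp.single j k).prod fun s n =>
      (MvPowerSeries.monomial (e s) 1 : MvPowerSeries ℕ ℂ) ^ n) = if d = k • e j then 1 else 0 := by
    intro j
    rw [Finsupp.prod_single_index (h := fun s n =>
      (MvPowerSeries.monomial (e s) 1 : MvPowerSeries ℕ ℂ) ^ n) (pow_zero _),
      MvPowerSeries.monomial_pow, one_pow,
      MvPowerSeries.coeff_monomial]
  have hps : ∀ c : ℕ →₀ ℕ, MvPowerSeries.coeff c (psum ℂ k : MvPowerSeries ℕ ℂ) =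
      if ∃ i, c = Finsupp.single i k then 1 else 0 := fun c => if_congr Iff.rfl rfl rfl
  beta_reduce
  rw [MvPowerSeries.substAlgHom_apply, MvPowerSeries.coeff_subst (hasSubst_monomial he he0)]
  by_cases h : ∃ j, d = k • e j
  · rw [if_pos h]
    obtain ⟨j, hj⟩ := h
    rw [finsum_eq_single _ (Finsupp.single j k), hprod, if_pos hj, hps, if_pos ⟨j, rfl⟩, smul_eq_mul,
      one_mul]
    intro c hc
    rw [hps]
    split_ifs with hi
    · obtain ⟨i, rfl⟩ := hi
      rw [hprod, if_neg, smul_zero]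
      intro hd
      exact hc (by rw [he (nsmul_right_injective hk.ne' (hj.symm.trans hd))])
    · rw [zero_smul]
  · rw [if_neg h]
    refine finsum_eq_zero_of_forall_eq_zero fun c => ?_
    rw [hps]
    split_ifs with hi
    · obtain ⟨i, rfl⟩ := hi
      rw [hprod, if_neg fun hd => h ⟨i, hd⟩, smul_zero]
    · rw [zero_smul]

end Substitution

/-- The plethysm `f[hₚ]` does not depend on the chosen expression of `f` in the power sums: it is
the substitution of the monomials of degree `p` for the variables. -/
theorem plethysm_hsymm {p : ℕ} (hp : 0 < p) (P : MvPolynomial ℕ+ ℂ) :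
    plethysm (MvPolynomial.aeval (fun k : ℕ+ => psum ℂ k) P) (hsymm ℂ p) =
      MvPolynomial.aeval (fun k : ℕ+ => powerSubst k (hsymm ℂ p)) P := by
  classical
  -- Since p > 0 there are countably infinitely many monomials of degree p, so they can be
  -- enumerated by the variables.
  have : Infinite {m : ℕ →₀ ℕ // m.degree = p} :=
    Infinite.of_injective (fun i => ⟨Finsupp.single i p, by simp⟩) fun i j hij =>
      Finsupp.single_left_injective hp.ne' (Subtype.ext_iff.1 hij)
  obtain ⟨e⟩ := nonempty_equiv_of_countable (α := ℕ) (β := {m : ℕ →₀ ℕ // m.degree = p})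
  have he : Function.Injective fun j => (e j : ℕ →₀ ℕ) := Subtype.val_injective.comp e.injective
  have he0 : ∀ j, (e j : ℕ →₀ ℕ) ≠ 0 := by
    intro j h
    have h' := (e j).2
    rw [h] at h'
    simp at h'
    omega
  let S := MvPowerSeries.substAlgHom (R := ℂ) (hasSubst_monomial he he0)
  -- Two algebra homomorphisms agreeing on generators. The right one factors through evaluation at
  -- the power sums, which gives independence of the chosen polynomial without algebraic
  -- independence.
  have key : (SymmFun ℂ).val.comp (MvPolynomial.aeval fun k : ℕ+ => powerSubst k (hsymm ℂ p)) =
      (S.comp (SymmFun ℂ).val).comp (MvPolynomial.aeval fun k : ℕ+ => psum ℂ k) := by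
    refine MvPolynomial.algHom_ext fun k => ?_
    simp only [AlgHom.comp_apply, MvPolynomial.aeval_X, Subalgebra.val_apply]
    ext d
    have h1 := isPowerSumFamily_powerSubst ℂ p k k.pos d
    have h2 := isPowerSumFamily_subst_psum he he0 k k.pos d
    simp only [PNat.coe_toPNat'] at h1
    refine h1.trans (Eq.trans ?_ h2.symm)
    exact if_congr (e.exists_congr_right
      (q := fun j : {m : ℕ →₀ ℕ // m.degree = p} => d = (k : ℕ) • j.1)).symm rfl rfl
  have hex : ∃ Q : MvPolynomial ℕ+ ℂ, MvPolynomial.aeval (fun k : ℕ+ => psum ℂ k) Q =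
      MvPolynomial.aeval (fun k : ℕ+ => psum ℂ k) P := ⟨P, rfl⟩
  rw [plethysm, dif_pos hex]
  refine Subtype.ext ((DFunLike.congr_fun key _).trans (Eq.trans ?_ (DFunLike.congr_fun key P).symm))
  simp only [AlgHom.comp_apply]
  rw [hex.choose_spec]

theorem plethysm_esymm_hsymm (r : ℕ) {p : ℕ} (hp : 0 < p) :
    plethysm (esymm ℂ r) (hsymm ℂ p) = (r.factorial : ℂ)⁻¹ • ∑ τ : Equiv.Perm (Fin r),
      ((Equiv.Perm.sign τ : ℤ) : ℂ) •
        (τ.partition.parts.map fun k => powerSubst k.toPNat' (hsymm ℂ p)).prod := by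
  have hr : (r.factorial : ℂ) ≠ 0 := Nat.cast_ne_zero.2 r.factorial_ne_zero
  let P : MvPolynomial ℕ+ ℂ := (r.factorial : ℂ)⁻¹ • ∑ τ : Equiv.Perm (Fin r),
    ((Equiv.Perm.sign τ : ℤ) : ℂ) •
      (τ.partition.parts.map fun k => MvPolynomial.X k.toPNat').prod
  have hP : ∀ g : ℕ+ → SymmFun ℂ, MvPolynomial.aeval g P =
      (r.factorial : ℂ)⁻¹ • ∑ τ : Equiv.Perm (Fin r), ((Equiv.Perm.sign τ : ℤ) : ℂ) •
        (τ.partition.parts.map fun k => g k.toPNat').prod := by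
    intro g
    simp only [P, map_smul, map_sum, map_multiset_prod, Multiset.map_map, Function.comp_def,
      MvPolynomial.aeval_X]
  have hE : MvPolynomial.aeval (fun k : ℕ+ => psum ℂ k) P = esymm ℂ r := by
    rw [hP, ← inv_smul_smul₀ hr (esymm ℂ r), factorial_smul_esymm]
    congr 1
    refine Finset.sum_congr rfl fun τ _ => ?_
    congr 2
    refine Multiset.map_congr rfl fun k hk => ?_
    rw [Nat.toPNat'_coe, if_pos (τ.partition.parts_pos hk)]
  rw [← hE, plethysm_hsymm hp, hP]

end SymmFun

/-! ## The character of the chain space -/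

theorem LinearMap.trace_lmapDomain {X : Type*} [Finite X] (f : X → X) :
    LinearMap.trace ℂ (X →₀ ℂ) (Finsupp.lmapDomain ℂ ℂ f) = Nat.card {x // f x = x} := by
  classical
  have := Fintype.ofFinite X
  rw [LinearMap.trace_eq_matrix_trace ℂ Finsupp.basisSingleOne, Matrix.trace,
    Nat.card_eq_fintype_card, Fintype.card_subtype, ← Finset.sum_boole]
  refine Finset.sum_congr rfl fun x _ => ?_
  rw [Matrix.diag_apply, LinearMap.toMatrix_apply, Finsupp.coe_basisSingleOne,
    Finsupp.lmapDomain_apply, Finsupp.mapDomain_single, Finsupp.basisSingleOne_repr,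
    LinearEquiv.refl_apply, Finsupp.single_apply]

namespace AbstractSimplicialComplex

variable {V : Type*} {K : AbstractSimplicialComplex V} {r : ℕ}

theorem OrderedFace.reorder_reorder (v : OrderedFace K r) (σ τ : Equiv.Perm (Fin r)) :
    (v.reorder σ).reorder τ = v.reorder (σ * τ) := rfl

variable (K r) in
/-- The antisymmetrization of ordered faces. -/
def antisymmetrizer : (OrderedFace K r →₀ ℂ) →ₗ[ℂ] (OrderedFace K r →₀ ℂ) :=
  (r.factorial : ℂ)⁻¹ • ∑ τ : Equiv.Perm (Fin r), ((Equiv.Perm.sign τ : ℤ) : ℂ) •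
    Finsupp.lmapDomain ℂ ℂ fun v : OrderedFace K r => v.reorder τ

theorem antisymmetrizer_single (v : OrderedFace K r) :
    antisymmetrizer K r (Finsupp.single v 1) = (r.factorial : ℂ)⁻¹ •
      ∑ τ : Equiv.Perm (Fin r), ((Equiv.Perm.sign τ : ℤ) : ℂ) •
        Finsupp.single (v.reorder τ) 1 := by
  simp only [antisymmetrizer, LinearMap.smul_apply, LinearMap.sum_apply, Finsupp.lmapDomain_apply,
    Finsupp.mapDomain_single]

theorem sign_mul_sign_self (σ : Equiv.Perm (Fin r)) :
    ((Equiv.Perm.sign σ : ℤ) : ℂ) * ((Equiv.Perm.sign σ : ℤ) : ℂ) = 1 := by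
  rw [← Int.cast_mul, ← Units.val_mul, Int.units_mul_self, Units.val_one, Int.cast_one]

/-- Reindexing the sum by τ ↦ στ pulls out sgn σ. -/
theorem orientationRel_le_ker : K.orientationRel r ≤ LinearMap.ker (antisymmetrizer K r) := by
  rw [orientationRel, Submodule.span_le]
  rintro _ ⟨⟨v, σ⟩, rfl⟩
  rw [SetLike.mem_coe, LinearMap.mem_ker, map_sub, map_smul, antisymmetrizer_single,
    antisymmetrizer_single, sub_eq_zero, smul_comm]
  congr 1
  rw [Finset.smul_sum]
  refine Eq.trans ?_ (Equiv.sum_comp (Equiv.mulLeft σ) _)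
  refine Finset.sum_congr rfl fun τ _ => ?_
  rw [Equiv.coe_mulLeft, OrderedFace.reorder_reorder, smul_smul, map_mul, Units.val_mul,
    Int.cast_mul]
  dsimp only
  rw [← mul_assoc, sign_mul_sign_self, one_mul]

/-- Modulo the relations all r! signed reorderings of a face coincide, so the map induced by the
antisymmetrizer is a section of the quotient map. -/
theorem mkQ_comp_antisymmetrizer :
    (K.orientationRel r).mkQ ∘ₗ antisymmetrizer K r = (K.orientationRel r).mkQ := by
  refine Finsupp.lhom_ext' fun v => LinearMap.ext_ring ?_
  simp only [LinearMap.comp_apply, Finsupp.lsingle_apply, antisymmetrizer_single, map_smul, map_sum]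
  have h : ∀ τ : Equiv.Perm (Fin r), ((Equiv.Perm.sign τ : ℤ) : ℂ) •
      (K.orientationRel r).mkQ (Finsupp.single (v.reorder τ) 1) =
      (K.orientationRel r).mkQ (Finsupp.single v 1) := by
    intro τ
    have h1 : (K.orientationRel r).mkQ (Finsupp.single (v.reorder τ) 1) =
        (K.orientationRel r).mkQ (((Equiv.Perm.sign τ : ℤ) : ℂ) • Finsupp.single v 1) :=
      (Submodule.Quotient.eq _).2 (Submodule.subset_span ⟨(v, τ), rfl⟩)
    rw [h1, map_smul, smul_smul, sign_mul_sign_self, one_smul]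
  rw [Finset.sum_congr rfl fun τ _ => h τ, Finset.sum_const, Finset.card_univ, Fintype.card_perm,
    Fintype.card_fin, ← Nat.cast_smul_eq_nsmul ℂ, smul_smul,
    inv_mul_cancel₀ (Nat.cast_ne_zero.2 r.factorial_ne_zero), one_smul]

theorem IsSimplicialAction.character_chainRep [DecidableEq V] [Finite V] {G : Type*} [Group G]
    [MulAction G V] (hG : K.IsSimplicialAction G) (g : G) :
    (hG.chainRep r).character g = (r.factorial : ℂ)⁻¹ * ∑ τ : Equiv.Perm (Fin r),
      ((Equiv.Perm.sign τ : ℤ) : ℂ) *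
        Nat.card {v : OrderedFace K r // hG.smulFace g (v.reorder τ) = v} := by
  let q := (K.orientationRel r).mkQ
  let s := (K.orientationRel r).liftQ (antisymmetrizer K r) orientationRel_le_ker
  have hsq : s ∘ₗ q = antisymmetrizer K r := Submodule.liftQ_mkQ _ _ _
  have hqs : q ∘ₗ s = LinearMap.id := by
    refine Submodule.linearMap_qext _ ?_
    rw [LinearMap.comp_assoc, hsq, mkQ_comp_antisymmetrizer, LinearMap.id_comp]
  have hρ : hG.chainRep r g ∘ₗ q = q ∘ₗ hG.orderedRep r g := rfl
  have h : hG.chainRep r g = q ∘ₗ (hG.orderedRep r g ∘ₗ s) := by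
    rw [← LinearMap.comp_assoc, ← hρ, LinearMap.comp_assoc, hqs, LinearMap.comp_id]
  have hc : ∀ τ : Equiv.Perm (Fin r), hG.orderedRep r g ∘ₗ
      Finsupp.lmapDomain ℂ ℂ (fun v : OrderedFace K r => v.reorder τ) =
      Finsupp.lmapDomain ℂ ℂ fun v : OrderedFace K r => hG.smulFace g (v.reorder τ) :=
    fun τ => (Finsupp.lmapDomain_comp ℂ ℂ _ _).symm
  -- Cyclicity of the trace turns q ∘ (g ∘ s) into g ∘ (s ∘ q), the action on ordered faces after
  -- antisymmetrization, where traces are fixed-point counts.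
  rw [Representation.character, h, LinearMap.trace_comp_comm', LinearMap.comp_assoc, hsq,
    antisymmetrizer, LinearMap.comp_smul, ← Module.End.mul_eq_comp, Finset.mul_sum, map_smul,
    map_sum, smul_eq_mul]
  congr 1
  refine Finset.sum_congr rfl fun τ _ => ?_
  rw [Module.End.mul_eq_comp, LinearMap.comp_smul, map_smul, hc, LinearMap.trace_lmapDomain,
    smul_eq_mul]

end AbstractSimplicialComplex

/-! ## Labelled faces of the matching complex -/

section Matching

open AbstractSimplicialComplex

variable {p n r : ℕ}

/-- Faces of the matching complex are pairwise disjoint. -/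
theorem disjoint_of_orderedFace (v : OrderedFace (hypergraphMatchingComplex p n) r) {i j : Fin r}
    (hij : i ≠ j) : Disjoint (v.1 i : Finset (Fin n)) (v.1 j : Finset (Fin n)) := by
  rcases v.2 with rfl | h
  · exact i.elim0
  · exact h.2 (by simp) (by simp) fun h => hij (v.1.injective h)

theorem exists_label (v : OrderedFace (hypergraphMatchingComplex p n) r) :
    ∃ L : Fin n → Option (Fin r), ∀ a i, L a = some i ↔ a ∈ (v.1 i : Finset (Fin n)) := by
  classical
  refine ⟨fun a => if h : ∃ i, a ∈ (v.1 i : Finset (Fin n)) then some h.choose else none,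
    fun a i => ?_⟩
  beta_reduce
  by_cases h : ∃ i, a ∈ (v.1 i : Finset (Fin n))
  · rw [dif_pos h, Option.some_inj]
    refine ⟨fun hi => hi ▸ h.choose_spec, fun hi => ?_⟩
    by_contra hne
    exact Finset.disjoint_left.1 (disjoint_of_orderedFace v hne) h.choose_spec hi
  · rw [dif_neg h]
    exact ⟨fun h' => by simp at h', fun hi => absurd ⟨i, hi⟩ h⟩

/-- The index of the member of an ordered matching that contains a given point, if there is one. -/
def label (v : OrderedFace (hypergraphMatchingComplex p n) r) : Fin n → Option (Fin r) :=
  (exists_label v).choose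

theorem label_eq_some_iff (v : OrderedFace (hypergraphMatchingComplex p n) r) (a : Fin n)
    (i : Fin r) : label v a = some i ↔ a ∈ (v.1 i : Finset (Fin n)) :=
  (exists_label v).choose_spec a i

theorem label_injective : Function.Injective
    (label : OrderedFace (hypergraphMatchingComplex p n) r → Fin n → Option (Fin r)) := by
  intro v v' h
  refine Subtype.ext (Function.Embedding.ext fun i => Subtype.ext (Finset.ext fun a => ?_))
  exact (label_eq_some_iff v a i).symm.trans (h ▸ label_eq_some_iff v' a i)

theorem card_label_fiber (v : OrderedFace (hypergraphMatchingComplex p n) r) (i : Fin r) :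
    (Finset.univ.filter fun a => label v a = some i).card = p := by
  have h : (Finset.univ.filter fun a => label v a = some i) = (v.1 i : Finset (Fin n)) := by
    ext a
    rw [Finset.mem_filter, label_eq_some_iff]
    simp
  rw [h]
  exact (v.1 i).2

/-- The members are the fibres of `L`; p > 0 makes them nonempty, hence distinct. -/
theorem exists_label_eq (hp : 0 < p) (L : Fin n → Option (Fin r))
    (hL : ∀ i, (Finset.univ.filter fun a => L a = some i).card = p) :
    ∃ v : OrderedFace (hypergraphMatchingComplex p n) r, label v = L := by
  classical
  let A : Fin r → Set.powersetCard (Fin n) p := fun i =>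
    ⟨Finset.univ.filter fun a => L a = some i, hL i⟩
  have hA : ∀ i a, a ∈ (A i : Finset (Fin n)) ↔ L a = some i := fun i a => by simp [A]
  have hinj : Function.Injective A := by
    intro i j hij
    obtain ⟨a, ha⟩ := Finset.card_pos.1 (hp.trans_eq (A i).2.symm)
    have h1 := (hA i a).1 ha
    have h2 := (hA j a).1 (hij ▸ ha)
    exact Option.some_inj.1 (h1.symm.trans h2)
  have hface : r = 0 ∨
      Finset.univ.map ⟨A, hinj⟩ ∈ (hypergraphMatchingComplex p n).faces := by
    rcases Nat.eq_zero_or_pos r with hr | hr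
    · exact Or.inl hr
    · have : Nonempty (Fin r) := ⟨⟨0, hr⟩⟩
      refine Or.inr ⟨Finset.univ_nonempty.map, ?_⟩
      intro B hB C hC hBC
      obtain ⟨i, -, rfl⟩ := Finset.mem_map.1 (Finset.mem_coe.1 hB)
      obtain ⟨j, -, rfl⟩ := Finset.mem_map.1 (Finset.mem_coe.1 hC)
      refine Finset.disjoint_left.2 fun a ha ha' => hBC ?_
      have h := ((hA i a).1 ha).symm.trans ((hA j a).1 ha')
      rw [Option.some_inj.1 h]
  refine ⟨⟨⟨A, hinj⟩, hface⟩, funext fun a => Option.ext fun i => ?_⟩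
  exact (label_eq_some_iff _ a i).trans (hA i a)

theorem label_smulFace (w : Equiv.Perm (Fin n))
    (v : OrderedFace (hypergraphMatchingComplex p n) r) (a : Fin n) :
    label ((hypergraphMatchingComplex_isSimplicialAction p n).smulFace w v) (w a) = label v a := by
  refine Option.ext fun i => ?_
  refine (label_eq_some_iff _ _ i).trans (Iff.trans ?_ (label_eq_some_iff v a i).symm)
  change w • a ∈ ((w • v.1 i : Set.powersetCard (Fin n) p) : Finset (Fin n)) ↔ _
  rw [Set.powersetCard.coe_smul, Finset.smul_mem_smul_finset_iff]

theorem map_label_reorder (τ : Equiv.Perm (Fin r))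
    (v : OrderedFace (hypergraphMatchingComplex p n) r) (a : Fin n) :
    (label (v.reorder τ) a).map τ = label v a := by
  refine Option.ext fun i => ?_
  rw [label_eq_some_iff, Option.map_eq_some_iff]
  constructor
  · rintro ⟨j, hj, rfl⟩
    exact (label_eq_some_iff _ a j).1 hj
  · intro h
    refine ⟨τ.symm i, (label_eq_some_iff _ a _).2 ?_, τ.apply_symm_apply i⟩
    change a ∈ (v.1 (τ (τ.symm i)) : Finset (Fin n))
    rwa [τ.apply_symm_apply]

/-! ## Contents of coloured faces -/

variable (p n r) in
/-- A colouring of the points with given content, together with an ordered matching. -/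
abbrev ColouredFace (d : ℕ →₀ ℕ) : Type :=
  OrderedFace (hypergraphMatchingComplex p n) r × {c : Fin n → ℕ // ∑ a, Finsupp.single (c a) 1 = d}

variable (p r) in
/-- The possible contents of the members of a matching and of its complement. -/
abbrev ContentFamily (q : ℕ) (d : ℕ →₀ ℕ) : Type :=
  {y : Option (Fin r) → ℕ →₀ ℕ //
    (∀ i, (y (some i)).degree = p) ∧ (y none).degree = q ∧ ∑ o, y o = d}

instance colouredFaceAction (d : ℕ →₀ ℕ) :
    MulAction (Equiv.Perm (Fin n)) (ColouredFace p n r d) where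
  smul w x := (((hypergraphMatchingComplex_isSimplicialAction p n).smulFace w x.1),
    ⟨x.2.1 ∘ ⇑w⁻¹, (Equiv.sum_comp w⁻¹ fun a => Finsupp.single (x.2.1 a) 1).trans x.2.2⟩)
  one_smul x := by
    refine Prod.ext (Subtype.ext (Function.Embedding.ext fun i => ?_)) (Subtype.ext ?_)
    · exact one_smul (Equiv.Perm (Fin n)) (x.1.1 i)
    · rfl
  mul_smul w w' x := by
    refine Prod.ext (Subtype.ext (Function.Embedding.ext fun i => ?_)) (Subtype.ext ?_)
    · exact mul_smul w w' (x.1.1 i)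
    · change x.2.1 ∘ ⇑(w * w')⁻¹ = (x.2.1 ∘ ⇑w'⁻¹) ∘ ⇑w⁻¹
      rw [mul_inv_rev, Equiv.Perm.coe_mul, Function.comp_assoc]

theorem smul_colouredFace_eq_iff {d : ℕ →₀ ℕ} (w : Equiv.Perm (Fin n))
    (x x' : ColouredFace p n r d) : w • x = x' ↔
      (hypergraphMatchingComplex_isSimplicialAction p n).smulFace w x.1 = x'.1 ∧
        x'.2.1 ∘ w = x.2.1 := by
  rw [Prod.ext_iff]
  refine and_congr Iff.rfl ?_
  rw [Subtype.ext_iff]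
  change x.2.1 ∘ ⇑w⁻¹ = x'.2.1 ↔ _
  constructor
  · rintro h
    rw [← h]
    funext a
    simp
  · intro h
    rw [← h]
    funext a
    simp

/-- The content of a coloured face. -/
def contentFun {d : ℕ →₀ ℕ} (x : ColouredFace p n r d) (o : Option (Fin r)) : ℕ →₀ ℕ :=
  ∑ a ∈ Finset.univ.filter (fun a => label x.1 a = o), Finsupp.single (x.2.1 a) 1

theorem contentFun_apply {d : ℕ →₀ ℕ} (x : ColouredFace p n r d) (o : Option (Fin r)) (k : ℕ) :
    contentFun x o k = (Finset.univ.filter fun a => (label x.1 a, x.2.1 a) = (o, k)).card := by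
  rw [contentFun, Finsupp.finsetSum_apply]
  simp only [Finsupp.single_apply, Prod.mk.injEq]
  rw [← Finset.card_filter, Finset.filter_filter]

theorem sum_contentFun {d : ℕ →₀ ℕ} (x : ColouredFace p n r d) : ∑ o, contentFun x o = d :=
  (Finset.sum_fiberwise Finset.univ (label x.1) _).trans x.2.2

theorem degree_contentFun_some {d : ℕ →₀ ℕ} (x : ColouredFace p n r d) (i : Fin r) :
    (contentFun x (some i)).degree = p := by
  rw [contentFun, SymmFun.degree_sum_single_one, card_label_fiber]

theorem degree_contentFun_none {d : ℕ →₀ ℕ} (x : ColouredFace p n r d) :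
    (contentFun x none).degree = n - r * p := by
  have h : (∑ o, contentFun x o).degree = n := by
    rw [sum_contentFun, ← x.2.2, SymmFun.degree_sum_single_one, Finset.card_univ, Fintype.card_fin]
  rw [Fintype.sum_option, map_add, map_sum] at h
  simp only [degree_contentFun_some, Finset.sum_const, Finset.card_univ, Fintype.card_fin,
    smul_eq_mul] at h
  omega

/-- The content of a coloured face, as a family indexed by the members and the complement. -/
def content {d : ℕ →₀ ℕ} (x : ColouredFace p n r d) : ContentFamily p r (n - r * p) d :=
  ⟨contentFun x, degree_contentFun_some x, degree_contentFun_none x, sum_contentFun x⟩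

/-- Contents record the fibre sizes of a ↦ (label, colour); equal sizes yield a permutation matching
the two maps, and labels determine the face. -/
theorem content_eq_iff {d : ℕ →₀ ℕ} (x x' : ColouredFace p n r d) :
    content x = content x' ↔ ∃ w : Equiv.Perm (Fin n), w • x = x' := by
  constructor
  · intro h
    have hfun : contentFun x = contentFun x' := Subtype.ext_iff.1 h
    obtain ⟨w, hw⟩ := exists_perm_comp_eq (F := fun a => (label x.1 a, x.2.1 a))
      (F' := fun a => (label x'.1 a, x'.2.1 a)) fun z => by
        rw [← contentFun_apply, ← contentFun_apply, hfun]
    have hw' : ∀ a, label x'.1 (w a) = label x.1 a ∧ x'.2.1 (w a) = x.2.1 a := fun a =>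
      Prod.ext_iff.1 (congrFun hw a)
    refine ⟨w, (smul_colouredFace_eq_iff w x x').2 ⟨label_injective (funext fun b => ?_),
      funext fun a => (hw' a).2⟩⟩
    obtain ⟨a, rfl⟩ := w.surjective b
    rw [label_smulFace, (hw' a).1]
  · rintro ⟨w, rfl⟩
    refine Subtype.ext (funext fun o => ?_)
    change contentFun x o = contentFun (w • x) o
    unfold contentFun
    refine Finset.sum_equiv w (fun a => ?_) fun a _ => ?_
    · simp only [Finset.mem_filter, Finset.mem_univ, true_and]
      exact Eq.congr_left (label_smulFace w x.1 a).symm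
    · change _ = Finsupp.single (x.2.1 (w⁻¹ (w a))) 1
      simp

theorem content_surjective (hp : 0 < p) (hr : r * p ≤ n) {d : ℕ →₀ ℕ} : Function.Surjective
    (content : ColouredFace p n r d → ContentFamily p r (n - r * p) d) := by
  classical
  rintro ⟨y, hy, hy0, hyd⟩
  -- N (o, k) is the prescribed number of points with label o and colour k; r * p ≤ n makes the
  -- total n.
  let N : (Option (Fin r) × ℕ) →₀ ℕ := (Finsupp.equivFunOnFinite.symm y).uncurry
  have hNdeg : N.degree = Fintype.card (Fin n) := by
    have h : N.degree = ∑ o, (y o).degree := by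
      have := Finsupp.sum_uncurry_index (Finsupp.equivFunOnFinite.symm y) fun _ m => m
      refine this.trans ?_
      exact Finsupp.sum_fintype _ _ fun _ => Finsupp.sum_zero_index
    rw [h, Fintype.sum_option, hy0, Finset.sum_congr rfl fun i _ => hy i]
    simp only [Finset.sum_const, Finset.card_univ, Fintype.card_fin, smul_eq_mul]
    omega
  obtain ⟨F, hF⟩ := exists_card_fiber_eq N hNdeg
  have hcontent : ∀ o, ∑ a ∈ Finset.univ.filter (fun a => (F a).1 = o),
      Finsupp.single (F a).2 1 = y o := by
    intro o
    ext k
    rw [Finsupp.finsetSum_apply]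
    simp only [Finsupp.single_apply]
    rw [← Finset.card_filter, Finset.filter_filter]
    refine Eq.trans ?_ (hF (o, k))
    simp only [Prod.ext_iff]
  obtain ⟨v, hv⟩ := exists_label_eq hp (fun a => (F a).1) fun i => by
    rw [← SymmFun.degree_sum_single_one _ fun a => (F a).2, hcontent, hy]
  refine ⟨(v, ⟨fun a => (F a).2, ?_⟩), Subtype.ext (funext fun o => ?_)⟩
  · rw [← hyd, ← Finset.sum_fiberwise Finset.univ fun a => (F a).1]
    exact Finset.sum_congr rfl fun o _ => hcontent o
  · change ∑ a ∈ Finset.univ.filter (fun a => label v a = o), Finsupp.single (F a).2 1 = y o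
    rw [hv]
    exact hcontent o

/-- Permutation of the members of a matching, on the level of contents. -/
def permContent {q : ℕ} {d : ℕ →₀ ℕ} (τ : Equiv.Perm (Fin r)) (y : ContentFamily p r q d) :
    ContentFamily p r q d :=
  ⟨fun o => y.1 (o.map τ), fun i => y.2.1 (τ i), y.2.2.1,
    (Equiv.sum_comp (Equiv.optionCongr τ) y.1).trans y.2.2.2⟩

theorem content_reorder {d : ℕ →₀ ℕ} (τ : Equiv.Perm (Fin r)) (x : ColouredFace p n r d) :
    content (x.1.reorder τ, x.2) = permContent τ (content x) := by
  refine Subtype.ext (funext fun o => ?_)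
  change contentFun _ o = contentFun x (o.map τ)
  unfold contentFun
  refine Finset.sum_congr (Finset.filter_congr fun a _ => ?_) fun _ _ => rfl
  rw [← map_label_reorder τ x.1 a]
  exact (Option.map_injective τ.injective).eq_iff.symm

/-- Twisted Burnside for coloured faces: the twist reorders the matching by τ and leaves the
colouring alone. -/
theorem sum_card_fixed_faces_mul_card_fixed_colourings (hp : 0 < p) (hr : r * p ≤ n)
    (τ : Equiv.Perm (Fin r)) (d : ℕ →₀ ℕ) :
    ∑ w : Equiv.Perm (Fin n),
      Nat.card {v : OrderedFace (hypergraphMatchingComplex p n) r //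
        (hypergraphMatchingComplex_isSimplicialAction p n).smulFace w (v.reorder τ) = v} *
      Nat.card {c : Fin n → ℕ // c ∘ w = c ∧ ∑ a, Finsupp.single (c a) 1 = d} =
      n.factorial * Nat.card {y : ContentFamily p r (n - r * p) d // permContent τ y = y} := by
  have := SymmFun.finite_colourings (α := Fin n) d
  have h := sum_card_twisted_fixed (G := Equiv.Perm (Fin n))
    (fun x : ColouredFace p n r d => (x.1.reorder τ, x.2)) (permContent τ) content
    (content_surjective hp hr) content_eq_iff (content_reorder τ)
  rw [Fintype.card_perm, Fintype.card_fin] at h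
  rw [← h]
  refine Finset.sum_congr rfl fun w _ => ?_
  rw [← Nat.card_prod]
  refine Nat.card_congr
    { toFun := fun z => ⟨(z.1.1, ⟨z.2.1, z.2.2.2⟩),
        (smul_colouredFace_eq_iff _ _ _).2 ⟨z.1.2, z.2.2.1⟩⟩
      invFun := fun x => (⟨x.1.1, ((smul_colouredFace_eq_iff _ _ _).1 x.2).1⟩,
        ⟨x.1.2.1, ((smul_colouredFace_eq_iff _ _ _).1 x.2).2, x.1.2.2⟩)
      left_inv := fun _ => rfl
      right_inv := fun _ => rfl }

open Classical in
-- A content family splits into its members, which τ permutes, and its complement, which τ fixes;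
-- the left side is the resulting Cauchy product coefficient.
theorem sum_antidiagonal_card (τ : Equiv.Perm (Fin r)) (q : ℕ) (d : ℕ →₀ ℕ) :
    ∑ z ∈ Finset.HasAntidiagonal.antidiagonal d, Nat.card {m : Fin r → {m : ℕ →₀ ℕ // m.degree = p} //
        m ∘ τ = m ∧ ∑ i, (m i).1 = z.1} * (if z.2.degree = q then 1 else 0) =
      Nat.card {y : ContentFamily p r q d // permContent τ y = y} := by
  have hfin : ∀ x : ℕ →₀ ℕ, Finite {m : Fin r → {m : ℕ →₀ ℕ // m.degree = p} //
      m ∘ τ = m ∧ ∑ i, (m i).1 = x} := by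
    intro x
    refine Finite.of_injective (β := Fin r → Finset.Iic x) (fun m i => ⟨(m.1 i).1, ?_⟩) ?_
    · rw [Finset.mem_Iic]
      refine le_of_le_of_eq ?_ m.2.2
      exact Finset.single_le_sum (f := fun i => (m.1 i).1) (fun _ _ => zero_le) (Finset.mem_univ i)
    · intro m m' h
      exact Subtype.ext (funext fun i => Subtype.ext (congrArg (fun f => (f i).1) h))
  simp only [mul_ite, mul_one, mul_zero]
  rw [← Finset.sum_filter, ← Finset.sum_coe_sort, ← Nat.card_sigma]
  have hsum : ∀ y : ContentFamily p r q d, ∑ i, y.1 (some i) + y.1 none = d := fun y =>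
    (add_comm _ _).trans ((Fintype.sum_option y.1).symm.trans y.2.2.2)
  symm
  refine Nat.card_congr
    { toFun := fun y => ⟨⟨(∑ i, y.1.1 (some i), y.1.1 none), ?_⟩,
        fun i => ⟨y.1.1 (some i), y.1.2.1 i⟩, ?_, rfl⟩
      invFun := fun z => ⟨⟨fun o => o.elim z.1.1.2 fun i => (z.2.1 i).1, fun i => (z.2.1 i).2,
        (Finset.mem_filter.1 z.1.2).2, ?_⟩, ?_⟩
      left_inv := ?_
      right_inv := ?_ }
  · rw [Finset.mem_filter, Finset.HasAntidiagonal.mem_antidiagonal]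
    exact ⟨hsum y.1, y.1.2.2.1⟩
  · exact funext fun i => Subtype.ext (congrFun (Subtype.ext_iff.1 y.2) (some i))
  · rw [Fintype.sum_option, add_comm]
    simp only [Option.elim]
    rw [z.2.2.2]
    exact Finset.HasAntidiagonal.mem_antidiagonal.1 (Finset.mem_filter.1 z.1.2).1
  · refine Subtype.ext (funext fun o => ?_)
    cases o with
    | none => rfl
    | some i => exact congrArg Subtype.val (congrFun z.2.2.1 i)
  · intro y
    refine Subtype.ext (Subtype.ext (funext fun o => ?_))
    cases o <;> rfl
  · rintro ⟨⟨⟨x, u⟩, hz⟩, m, hm, hx⟩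
    exact Sigma.subtype_ext (Subtype.ext (Prod.ext hx rfl)) rfl

end Matching

end

/-! ### Comparison of coefficients -/

theorem proposition5p6 (p n r : ℕ) (hp : 2 ≤ p) (hn : 2 ≤ n) (hr : r ≤ n / p) :
    frobeniusChar (matchingChainRep p n r) =
      SymmFun.plethysm (SymmFun.esymm ℂ r) (SymmFun.hsymm ℂ p) * SymmFun.hsymm ℂ (n - r * p) := by
  classical
  have hp0 : 0 < p := by omega
  have hrp : r * p ≤ n := (Nat.le_div_iff_mul_le hp0).1 hr
  have hn0 : (n.factorial : ℂ) ≠ 0 := Nat.cast_ne_zero.2 n.factorial_ne_zero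
  refine Subtype.ext (MvPowerSeries.ext fun d => ?_)
  let Y : Equiv.Perm (Fin r) → ℂ := fun τ =>
    Nat.card {y : ContentFamily p r (n - r * p) d // permContent τ y = y}
  -- Both coefficients equal the signed count of invariant content families.
  trans (r.factorial : ℂ)⁻¹ * ∑ τ : Equiv.Perm (Fin r), ((Equiv.Perm.sign τ : ℤ) : ℂ) * Y τ
  · have hcoe : (frobeniusChar (matchingChainRep p n r)).1 = (n.factorial : ℂ)⁻¹ •
        ∑ w : Equiv.Perm (Fin n), (matchingChainRep p n r).character w •
          (w.partition.parts.map fun k => (SymmFun.psum ℂ k : MvPowerSeries ℕ ℂ)).prod := by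
      rw [frobeniusChar, ← Subalgebra.val_apply, map_smul, map_sum]
      congr 1
      refine Finset.sum_congr rfl fun w _ => ?_
      rw [map_smul, Subalgebra.val_apply, SymmFun.coe_multiset_prod]
    rw [hcoe, map_smul, map_sum]
    simp only [map_smul, smul_eq_mul, matchingChainRep,
      (SymmFun.isPowerSumFamily_psum ℂ).coeff_prod_partition SymmFun.single_one_injective,
      AbstractSimplicialComplex.IsSimplicialAction.character_chainRep]
    simp only [mul_assoc, Finset.sum_mul]
    rw [← Finset.mul_sum, Finset.sum_comm, mul_left_comm]
    congr 1
    rw [Finset.mul_sum]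
    refine Finset.sum_congr rfl fun τ _ => ?_
    rw [← Finset.mul_sum, mul_left_comm]
    congr 1
    rw [inv_mul_eq_iff_eq_mul₀ hn0]
    simp only [Y]
    exact_mod_cast sum_card_fixed_faces_mul_card_fixed_colourings hp0 hrp τ d
  · have hcoe : (SymmFun.plethysm (SymmFun.esymm ℂ r) (SymmFun.hsymm ℂ p) *
        SymmFun.hsymm ℂ (n - r * p)).1 = (r.factorial : ℂ)⁻¹ • ∑ τ : Equiv.Perm (Fin r),
          ((Equiv.Perm.sign τ : ℤ) : ℂ) • ((τ.partition.parts.map fun k =>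
            (SymmFun.powerSubst k.toPNat' (SymmFun.hsymm ℂ p) : MvPowerSeries ℕ ℂ)).prod *
              (SymmFun.hsymm ℂ (n - r * p) : MvPowerSeries ℕ ℂ)) := by
      rw [SymmFun.plethysm_esymm_hsymm r hp0, smul_mul_assoc, Finset.sum_mul,
        ← Subalgebra.val_apply, map_smul, map_sum]
      congr 1
      refine Finset.sum_congr rfl fun τ _ => ?_
      rw [smul_mul_assoc, map_smul, map_mul, Subalgebra.val_apply, Subalgebra.val_apply,
        SymmFun.coe_multiset_prod]
    rw [hcoe, map_smul, map_sum, smul_eq_mul]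
    congr 1
    refine Finset.sum_congr rfl fun τ _ => ?_
    rw [map_smul, smul_eq_mul, MvPowerSeries.coeff_mul]
    congr 1
    simp only [SymmFun.coe_hsymm_coeff,
      (SymmFun.isPowerSumFamily_powerSubst ℂ p).coeff_prod_partition
      Subtype.val_injective]
    simp only [Y, ← sum_antidiagonal_card]
    push_cast
    rfl
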